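/- **Proposition 6.1.** A *hypergraph* consists of a set $V$ of vertices and a set of hyperedges, where a hyperedge is a finite subset of $V$ containing at least two vertices; two distinct vertices are *adjacent* if they belong to a common hyperedge. A *cycle* is a closed path $v_1,v_2,\dots,v_k,v_1$ $(k\ge 3)$ of consecutively adjacent, pairwise distinct vertices. A *hyperforest* is a hypergraph in which any two distinct hyperedges have at most one common vertex and every cycle is contained in a hyperedge. Let $\mathcal{HF}$ be the set of all hyperforests with vertices $1,2,3,\dots$ and finitely many hyperedges, partially ordered by inclusion: $F'\le F$ if every hyperedge of $F'$ is contained in some hyperedge of $F$. Its minimal element $\hat 0$ is the hyperforest without hyperedges, and every $F\in\mathcal{HF}$ has only finitely many $F'\le F$. Let $\mu:\mathcal{HF}\to\mathbb Z$ be the Möbius function, defined recursively by $\mu(\hat 0)=1$ and $\mu(F)=-\sum_{F'<F}\mu(F')$ for $F\neq\hat 0$. Then for every $F\in\mathcal{HF}$ $$\mu(F)=\prod_{j\ge 2}\bigl(-(j-2)!\bigr)^{\kappa_j},$$ where $\kappa_j$ is the number of hyperedges of $F$ with exactly $j$ vertices (only finitely many factors differ from $1$). -/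

import Mathlib

/-- The primal graph of a family of hyperedges on the vertex set `V`: two distinct vertices are
joined by an edge if they are adjacent, i.e. if they belong to a common hyperedge. -/
def primalGraph {V : Type*} (edges : Finset (Finset V)) : SimpleGraph V where
  Adj v w := v ≠ w ∧ ∃ e ∈ edges, v ∈ e ∧ w ∈ e
  symm := ⟨fun _ _ h => ⟨h.1.symm, h.2.imp fun _ he => ⟨he.1, he.2.2, he.2.1⟩⟩⟩
  loopless := ⟨fun _ h => h.1 rfl⟩

/-- A hyperforest with labelled vertices, the elements of `V`, and with finitely many (finite)
hyperedges. Vertices that belong to no hyperedge are isolated. -/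
@[ext]
structure Hyperforest (V : Type*) where
  /-- The set of hyperedges. -/
  edges : Finset (Finset V)
  /-- A hyperedge contains at least two vertices. -/
  two_le_card : ∀ e ∈ edges, 2 ≤ e.card
  /-- Distinct hyperedges intersect in at most one common vertex. -/
  eq_of_mem_of_mem : ∀ e ∈ edges, ∀ f ∈ edges, e ≠ f →
    ∀ v w : V, v ∈ e → v ∈ f → w ∈ e → w ∈ f → v = w
  /-- The vertices of a cycle (a closed path of consecutively adjacent vertices, distinct apart
  from the common start and end) are all contained in a single hyperedge. -/
  exists_of_isCycle : ∀ (v : V) (p : (primalGraph edges).Walk v v), p.IsCycle →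
    ∃ e ∈ edges, ∀ w ∈ p.support, w ∈ e

namespace Hyperforest

variable {V : Type*}

/-- The number of hyperedges with exactly `j` vertices. -/
def kappa (F : Hyperforest V) (j : ℕ) : ℕ :=
  (F.edges.filter fun e => e.card = j).card

instance [DecidableEq V] : DecidableEq (Hyperforest V) := fun F G =>
  decidable_of_iff (F.edges = G.edges) Hyperforest.ext_iff.symm

/-- In a hyperforest, a hyperedge contained in another one is equal to it. -/
theorem eq_of_subset (F : Hyperforest V) {e f : Finset V} (he : e ∈ F.edges) (hf : f ∈ F.edges)
    (h : e ⊆ f) : e = f := by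
  by_contra hne
  obtain ⟨v, hv, w, hw, hvw⟩ := Finset.one_lt_card.1 (F.two_le_card e he)
  exact hvw (F.eq_of_mem_of_mem e he f hf hne v w hv (h hv) hw (h hw))

/-- The order by inclusion: `F ≤ G` if every hyperedge of `F` is contained in some hyperedge
of `G`. -/
instance : LE (Hyperforest V) := ⟨fun F G => ∀ e ∈ F.edges, ∃ f ∈ G.edges, e ⊆ f⟩

theorem le_def {F G : Hyperforest V} : F ≤ G ↔ ∀ e ∈ F.edges, ∃ f ∈ G.edges, e ⊆ f := Iff.rfl

theorem edges_subset_of_le_of_le {F G : Hyperforest V} (h : F ≤ G) (h' : G ≤ F) :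
    F.edges ⊆ G.edges := by
  intro e he
  obtain ⟨f, hf, hef⟩ := h e he
  obtain ⟨e', he', hfe⟩ := h' f hf
  have h1 : e = e' := F.eq_of_subset he he' (hef.trans hfe)
  have h2 : e = f := Finset.Subset.antisymm hef (h1 ▸ hfe)
  exact h2 ▸ hf

instance : PartialOrder (Hyperforest V) where
  le_refl F e he := ⟨e, he, Finset.Subset.refl e⟩
  le_trans F G H h h' e he := by
    obtain ⟨f, hf, hef⟩ := h e he
    obtain ⟨g, hg, hfg⟩ := h' f hf
    exact ⟨g, hg, hef.trans hfg⟩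
  le_antisymm F G h h' := Hyperforest.ext (Finset.Subset.antisymm
    (edges_subset_of_le_of_le h h') (edges_subset_of_le_of_le h' h))

/-- The minimal element is the trivial hyperforest, all of whose vertices are isolated. -/
instance : OrderBot (Hyperforest V) where
  bot :=
    { edges := ∅
      two_le_card := by simp
      eq_of_mem_of_mem := by simp
      exists_of_isCycle := by
        intro v p hp
        cases p with
        | nil => exact absurd rfl hp.ne_nil
        | cons h q =>
          obtain ⟨-, e, he, -⟩ := h
          simp at he }
  bot_le F e he := absurd he (Finset.notMem_empty e)

/-- Only finitely many hyperforests are contained in a given one. -/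
theorem finite_Iic (G : Hyperforest V) : (Set.Iic G).Finite := by
  classical
  refine Set.Finite.of_finite_image (f := edges)
    (((G.edges.biUnion Finset.powerset).powerset.finite_toSet).subset ?_)
    (fun F _ F' _ h => Hyperforest.ext h)
  rintro _ ⟨F, hF, rfl⟩
  rw [Finset.mem_coe, Finset.mem_powerset]
  intro e he
  obtain ⟨f, hf, hef⟩ := hF e he
  exact Finset.mem_biUnion.2 ⟨f, hf, Finset.mem_powerset.2 hef⟩

noncomputable instance : LocallyFiniteOrder (Hyperforest V) :=
  LocallyFiniteOrder.ofFiniteIcc fun _ G => (finite_Iic G).subset Set.Icc_subset_Iic_self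

end Hyperforest

open scoped Nat

/-! Let the weight of a hyperforest be the product of `-(j-2)!` over its hyperedges, `j` being the
size. The weights below `F` sum to 0 for `F ≠ ⊥` (`sum_weight_lowerEdges`), so the weight obeys the
recursion defining `μ`.

For the vanishing, fix distinct `u`, `v` in a hyperedge `E` of `F`. Each `s ≤ F` linking `u` and `v`
arises exactly once from some `s' ≤ F` not linking them: `v` is attached inside `E` to the component
of `u`, either by a new pair `{c, v}` or by enlarging a hyperedge `d` to `d ∪ {v}`
(`sum_weight_linked`). The weight is multiplied by `-1` or by `|d| - 1` respectively. If `C` is the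
set of vertices of `E` linked to `u`, then `∑ (|d| - 1) = |C| - 1` by tree counting, so the factors
add up to `-|C| + (|C| - 1) = -1` (`sum_weight_attach`), and everything linked cancels against `s'`.
-/

namespace Hyperforest

/-! ### Connectivity, and acyclicity as a substitute for the cycle condition -/

variable {V : Type*}

/-- Two vertices are linked if they are joined by a sequence of vertices any two consecutive ones
of which belong to a common member of `s`. -/
def Linked (s : Finset (Finset V)) : V → V → Prop :=
  Relation.ReflTransGen fun a b => ∃ e ∈ s, a ∈ e ∧ b ∈ e

namespace Linked

variable {s t : Finset (Finset V)} {e : Finset V} {a b c : V}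

theorem refl (s : Finset (Finset V)) (a : V) : Linked s a a := Relation.ReflTransGen.refl

theorem trans (h : Linked s a b) (h' : Linked s b c) : Linked s a c :=
  Relation.ReflTransGen.trans h h'

theorem symm (h : Linked s a b) : Linked s b a := by
  induction h with
  | refl => exact refl _ _
  | tail _ h ih =>
    obtain ⟨e, he, h1, h2⟩ := h
    exact Relation.ReflTransGen.head ⟨e, he, h2, h1⟩ ih

theorem of_mem (he : e ∈ s) (ha : a ∈ e) (hb : b ∈ e) : Linked s a b :=
  Relation.ReflTransGen.single ⟨e, he, ha, hb⟩

theorem of_forall (h : Linked s a b)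
    (H : ∀ e ∈ s, ∀ x ∈ e, ∀ y ∈ e, Linked t x y) : Linked t a b := by
  induction h with
  | refl => exact refl _ _
  | tail _ h ih =>
    obtain ⟨e, he, h1, h2⟩ := h
    exact ih.trans (H e he _ h1 _ h2)

theorem mono (h : Linked s a b) (hst : s ⊆ t) : Linked t a b :=
  h.of_forall fun _ he _ hx _ hy => of_mem (hst he) hx hy

variable [DecidableEq V]

/-- Either a connection avoids the member `e`, or its part before reaching `e` does. -/
theorem erase_or (h : Linked s a b) (e : Finset V) :
    Linked (s.erase e) a b ∨ ∃ c ∈ e, Linked (s.erase e) a c := by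
  induction h with
  | refl => exact Or.inl (refl _ _)
  | tail _ h ih =>
    obtain ⟨g, hg, h1, h2⟩ := h
    rcases ih with ih | ih
    · by_cases hge : g = e
      · exact Or.inr ⟨_, hge ▸ h1, ih⟩
      · exact Or.inl (ih.trans (of_mem (Finset.mem_erase.2 ⟨hge, hg⟩) h1 h2))
    · exact Or.inr ih

theorem exists_mem_erase (h : Linked s a b) (hb : b ∈ e) :
    ∃ c ∈ e, Linked (s.erase e) a c := by
  rcases h.erase_or e with h | h
  · exact ⟨b, hb, h⟩
  · exact h

/-- A connection is cut at its first and its last visit to `e`. -/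
theorem of_insert (h : Linked (insert e s) a b) :
    Linked s a b ∨ ∃ p ∈ e, ∃ q ∈ e, Linked s a p ∧ Linked s q b := by
  have hsub : (insert e s).erase e ⊆ s := by
    intro g hg
    rw [Finset.mem_erase, Finset.mem_insert] at hg
    exact hg.2.resolve_left hg.1
  rcases h.erase_or e with h1 | ⟨p, hp, h1⟩
  · exact Or.inl (h1.mono hsub)
  rcases h.symm.erase_or e with h2 | ⟨q, hq, h2⟩
  · exact Or.inl (h2.symm.mono hsub)
  · exact Or.inr ⟨p, hp, q, hq, h1.mono hsub, (h2.mono hsub).symm⟩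

end Linked

theorem reachable_of_linked {s : Finset (Finset V)} {a b : V} (h : Linked s a b) :
    (primalGraph s).Reachable a b := by
  induction h with
  | refl => exact SimpleGraph.Reachable.refl _
  | @tail x y _ h ih =>
    by_cases hxy : x = y
    · exact hxy ▸ ih
    · exact ih.trans (SimpleGraph.Adj.reachable ⟨hxy, h⟩)

variable [DecidableEq V]

/-- A family of finite sets is acyclic if removing a member separates its elements from each
other. -/
def Acyclic (s : Finset (Finset V)) : Prop :=
  ∀ e ∈ s, ∀ a ∈ e, ∀ b ∈ e, Linked (s.erase e) a b → a = b

theorem Acyclic.mono {s t : Finset (Finset V)} (h : Acyclic t) (hst : s ⊆ t) : Acyclic s :=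
  fun e he a ha b hb hab => h e (hst he) a ha b hb (hab.mono (Finset.erase_subset_erase e hst))

theorem Acyclic.eq_of_mem {s : Finset (Finset V)} (h : Acyclic s) {e f : Finset V} (he : e ∈ s)
    (hf : f ∈ s) (hne : e ≠ f) {a b : V} (hae : a ∈ e) (haf : a ∈ f) (hbe : b ∈ e)
    (hbf : b ∈ f) : a = b :=
  h e he a hae b hbe (Linked.of_mem (Finset.mem_erase.2 ⟨hne.symm, hf⟩) haf hbf)

/-- Up to its first vertex in `e`, the walk cannot use `e`. -/
theorem exists_mem_support_linked_erase {s : Finset (Finset V)} {e : Finset V} {z c : V}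
    (p : (primalGraph s).Walk z c) (hc : c ∈ e) :
    ∃ a ∈ p.support, a ∈ e ∧ Linked (s.erase e) z a := by
  induction p with
  | nil => exact ⟨_, by simp, hc, Linked.refl _ _⟩
  | @cons x y w h q ih =>
    by_cases hx : x ∈ e
    · exact ⟨x, by simp, hx, Linked.refl _ _⟩
    · obtain ⟨a, ha, hae, hl⟩ := ih hc
      obtain ⟨g, hg, hxg, hyg⟩ := h.2
      refine ⟨a, by simp [ha], hae, (Linked.of_mem (Finset.mem_erase.2 ⟨?_, hg⟩) hxg hyg).trans hl⟩
      rintro rfl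
      exact hx hxg

/-- Let `e` carry the first edge of the cycle. From a vertex `z` outside `e`, the two arcs reach `e`
without using it, hence at the same vertex by acyclicity; but the arcs share only `z`. -/
theorem Acyclic.exists_of_isCycle {s : Finset (Finset V)} (hs : Acyclic s) (v : V)
    (p : (primalGraph s).Walk v v) (hp : p.IsCycle) : ∃ e ∈ s, ∀ w ∈ p.support, w ∈ e := by
  cases p with
  | nil => exact absurd rfl hp.ne_nil
  | @cons _ c _ h q =>
    obtain ⟨hvc, e, he, hve, hce⟩ := id h
    refine ⟨e, he, fun z hz => ?_⟩
    by_contra hze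
    have hq := ((SimpleGraph.Walk.cons_isCycle_iff q h).1 hp).1
    have hzq : z ∈ q.support := by
      rw [SimpleGraph.Walk.support_cons, List.mem_cons] at hz
      exact hz.resolve_left (fun h => hze (h ▸ hve))
    obtain ⟨a, ha, hae, hza⟩ := exists_mem_support_linked_erase (q.takeUntil z hzq).reverse hce
    obtain ⟨b, hb, hbe, hzb⟩ := exists_mem_support_linked_erase (q.dropUntil z hzq) hve
    have hab : a = b := hs e he a hae b hbe (hza.symm.trans hzb)
    subst hab
    rw [SimpleGraph.Walk.support_reverse, List.mem_reverse] at ha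
    have hnd := hq.support_nodup
    rw [← q.take_spec hzq, SimpleGraph.Walk.support_append, List.nodup_append'] at hnd
    rw [SimpleGraph.Walk.mem_support_iff] at hb
    rcases hb with rfl | hb
    · exact hze hae
    · exact hnd.2.2 ha hb

/-- A path from `a` to `b` avoiding `e`, closed up through `e`, is a cycle. The hyperedge containing
it shares `a` and `b` with `e`, so it is `e`; then the first edge of the path lies in `e` and in
another hyperedge. -/
theorem acyclic_edges (F : Hyperforest V) : Acyclic F.edges := by
  intro e he a ha b hb hab
  by_contra hne
  obtain ⟨p, hp⟩ := (reachable_of_linked hab).exists_isPath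
  have hle : primalGraph (F.edges.erase e) ≤ primalGraph F.edges := fun x y h =>
    ⟨h.1, h.2.imp fun g hg => ⟨Finset.mem_of_mem_erase hg.1, hg.2⟩⟩
  have hadj : (primalGraph F.edges).Adj b a := ⟨Ne.symm hne, e, he, hb, ha⟩
  have hcyc : (SimpleGraph.Walk.cons hadj (p.mapLe hle)).IsCycle := by
    rw [SimpleGraph.Walk.cons_isCycle_iff]
    refine ⟨hp.mapLe hle, fun hmem => ?_⟩
    rw [SimpleGraph.Walk.edges_mapLe_eq_edges] at hmem
    obtain ⟨-, g, hg, hbg, hag⟩ := p.adj_of_mem_edges hmem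
    rw [Finset.mem_erase] at hg
    exact hne (F.eq_of_mem_of_mem e he g hg.2 hg.1.symm a b ha hag hb hbg)
  obtain ⟨g, hg, hsup⟩ := F.exists_of_isCycle _ _ hcyc
  simp only [SimpleGraph.Walk.support_cons, SimpleGraph.Walk.support_mapLe_eq_support,
    List.mem_cons] at hsup
  have hge : g = e := by
    by_contra hge
    exact hne (F.eq_of_mem_of_mem e he g hg (Ne.symm hge) a b ha
      (hsup a (Or.inr p.start_mem_support)) hb (hsup b (Or.inl rfl)))
  subst hge
  cases p with
  | nil => exact hne rfl
  | @cons _ c _ h q =>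
    obtain ⟨hac, f, hf, haf, hcf⟩ := id h
    rw [Finset.mem_erase] at hf
    exact hac (F.eq_of_mem_of_mem g he f hf.2 hf.1.symm a c ha haf (hsup c (Or.inr (by simp))) hcf)

/-- The hyperforest with a given acyclic set of hyperedges. -/
def ofAcyclic (s : Finset (Finset V)) (h2 : ∀ e ∈ s, 2 ≤ e.card) (hs : Acyclic s) :
    Hyperforest V where
  edges := s
  two_le_card := h2
  eq_of_mem_of_mem _ he _ hf hne _ _ h1 h2 h3 h4 := hs.eq_of_mem he hf hne h1 h2 h3 h4
  exists_of_isCycle := hs.exists_of_isCycle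

/-- The sets of hyperedges of the hyperforests contained in `F`. -/
noncomputable def lowerEdges (F : Hyperforest V) : Finset (Finset (Finset V)) :=
  (Finset.Iic F).image edges

theorem mem_lowerEdges {F : Hyperforest V} {s : Finset (Finset V)} :
    s ∈ F.lowerEdges ↔ (∀ e ∈ s, 2 ≤ e.card) ∧ Acyclic s ∧ ∀ e ∈ s, ∃ f ∈ F.edges, e ⊆ f := by
  simp only [lowerEdges, Finset.mem_image, Finset.mem_Iic]
  constructor
  · rintro ⟨G, hG, rfl⟩
    exact ⟨G.two_le_card, G.acyclic_edges, hG⟩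
  · rintro ⟨h1, h2, h3⟩
    exact ⟨ofAcyclic s h1 h2, h3, rfl⟩

end Hyperforest

/-! ### Stubs, parents and tree counting -/

namespace Hyperforest

variable {V : Type*}
/-- A place where a new vertex can be attached to the component of `u`: a vertex of the component
or a hyperedge of it. -/
structure IsStub (s : Finset (Finset V)) (u : V) (d : Finset V) : Prop where
  nonempty : d.Nonempty
  mem_or : d ∈ s ∨ d.card = 1
  linked : ∀ x ∈ d, Linked s u x

theorem IsStub.notMem {s : Finset (Finset V)} {u v : V} {d : Finset V} (hd : IsStub s u d)
    (huv : ¬ Linked s u v) : v ∉ d :=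
  fun h => huv (hd.linked v h)

variable [DecidableEq V]

/-- An excursion out of `E` can only return to the vertex where it left, so it can be dropped. -/
theorem Acyclic.linked_filter_subset {r t : Finset (Finset V)} (hr : Acyclic r)
    (ht : ∀ g ∈ t, ∃ f ∈ r, g ⊆ f) {E : Finset V} (hE : E ∈ r) {a b : V} (ha : a ∈ E)
    (hb : b ∈ E) (h : Linked t a b) : Linked (t.filter (· ⊆ E)) a b := by
  -- Invariant: `c` is where the current excursion out of `E` began.
  have key : ∃ c ∈ E, Linked (t.filter (· ⊆ E)) a c ∧ Linked (r.erase E) c b := by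
    clear hb
    induction h with
    | refl => exact ⟨a, ha, Linked.refl _ _, Linked.refl _ _⟩
    | @tail x y _ h ih =>
      obtain ⟨c, hc, hac, hcx⟩ := ih
      obtain ⟨g, hg, hxg, hyg⟩ := h
      obtain ⟨f, hf, hgf⟩ := ht g hg
      by_cases hfE : f = E
      · subst hfE
        have := hr f hE c hc x (hgf hxg) hcx
        subst this
        exact ⟨y, hgf hyg, hac.trans (Linked.of_mem (Finset.mem_filter.2 ⟨hg, hgf⟩) hxg hyg),
          Linked.refl _ _⟩
      · exact ⟨c, hc, hac, hcx.trans
          (Linked.of_mem (Finset.mem_erase.2 ⟨hfE, hf⟩) (hgf hxg) (hgf hyg))⟩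
  obtain ⟨c, hc, hac, hcb⟩ := key
  exact hr E hE c hc b hb hcb ▸ hac

/-- In an acyclic family rooted at `u`, the member `e` is the one that leads from `v` towards
the root. -/
def IsParent (s : Finset (Finset V)) (u v : V) (e : Finset V) : Prop :=
  e ∈ s ∧ v ∈ e ∧ ∃ w ∈ e, w ≠ v ∧ Linked (s.erase e) u w

/-- Consider the last member `e` of the connection. If `e` is first reached at a vertex other than
`v`, it is the parent; otherwise `e` is superfluous and can be deleted. -/
theorem exists_isParent {s : Finset (Finset V)} {u v : V} (h : Linked s u v) (huv : u ≠ v) :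
    ∃ e, IsParent s u v e := by
  induction hn : s.card generalizing s with
  | zero =>
    rw [Finset.card_eq_zero] at hn
    subst hn
    cases h with
    | refl => exact absurd rfl huv
    | tail _ h => simp at h
  | succ n ih =>
    cases Relation.ReflTransGen.cases_tail h with
    | inl h => exact absurd h.symm huv
    | inr h' =>
      obtain ⟨x, -, e, he, -, hve⟩ := h'
      obtain ⟨w, hw, hl⟩ := h.exists_mem_erase hve
      by_cases hwv : w = v
      · subst hwv
        obtain ⟨e', he', hv', w', hw', hne, hl'⟩ := ih hl (by rw [Finset.card_erase_of_mem he, hn]; rfl)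
        exact ⟨e', Finset.mem_of_mem_erase he', hv', w', hw', hne,
          hl'.mono (Finset.erase_subset_erase _ (Finset.erase_subset _ _))⟩
      · exact ⟨e, he, hve, w, hw, hwv, hl⟩

theorem IsParent.linked {s : Finset (Finset V)} {u v : V} {e : Finset V} (h : IsParent s u v e) :
    Linked s u v := by
  obtain ⟨he, hv, w, hw, -, hl⟩ := h
  exact (hl.mono (Finset.erase_subset _ _)).trans (Linked.of_mem he hw hv)

theorem Acyclic.isParent_iff {s : Finset (Finset V)} (hs : Acyclic s) {u v : V} {e : Finset V} :
    IsParent s u v e ↔ e ∈ s ∧ v ∈ e ∧ Linked s u v ∧ ¬ Linked (s.erase e) u v := by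
  constructor
  · intro h
    refine ⟨h.1, h.2.1, h.linked, fun hv => ?_⟩
    obtain ⟨he, hve, w, hw, hne, hl⟩ := h
    exact hne (hs e he w hw v hve (hl.symm.trans hv))
  · rintro ⟨he, hve, hl, hnl⟩
    obtain ⟨w, hw, hlw⟩ := hl.exists_mem_erase hve
    exact ⟨he, hve, w, hw, fun h => hnl (h ▸ hlw), hlw⟩

theorem Acyclic.isParent_unique {s : Finset (Finset V)} (hs : Acyclic s) {u v : V}
    {e f : Finset V} (he : IsParent s u v e) (hf : IsParent s u v f) : e = f := by
  by_contra hne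
  rw [hs.isParent_iff] at hf
  obtain ⟨hf, hvf, -, hnl⟩ := hf
  obtain ⟨he, hve, w, hw, hwv, hl⟩ := he
  -- Either `e` links `u` to `v` without `f`, or `f` links `w` to `v` without `e`.
  rcases hl.symm.erase_or f with h | ⟨c, hc, h⟩
  · refine hnl ((h.mono (Finset.erase_subset_erase _ (Finset.erase_subset _ _))).symm.trans ?_)
    exact Linked.of_mem (Finset.mem_erase.2 ⟨hne, he⟩) hw hve
  · refine hwv (hs e he w hw v hve ((h.mono (Finset.erase_subset _ _)).trans ?_))
    exact Linked.of_mem (Finset.mem_erase.2 ⟨Ne.symm hne, hf⟩) hc hvf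

open Classical in
/-- The number of vertices of a hypertree is determined by the sizes of its hyperedges. -/
theorem Acyclic.sum_card_sub_one {s : Finset (Finset V)} (hs : Acyclic s)
    (hne : ∀ e ∈ s, e.Nonempty) {E : Finset V} (hE : ∀ e ∈ s, e ⊆ E) {u : V} (hu : u ∈ E) :
    ∑ e ∈ s.filter (fun e => ∀ x ∈ e, Linked s u x), ((e.card : ℤ) - 1) =
      ((E.filter (Linked s u)).card : ℤ) - 1 := by
  set S := s.filter (fun e => ∀ x ∈ e, Linked s u x) with hS
  -- The children of `e`: all its vertices but the one nearest to `u`. Each vertex of the component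
  -- except `u` is a child of its parent only.
  let ch : Finset V → Finset V := fun e => e.filter fun c => ¬ Linked (s.erase e) u c
  have hch : ∀ e ∈ S, ((e.card : ℤ) - 1) = (ch e).card := by
    intro e he
    obtain ⟨he, hl⟩ := Finset.mem_filter.1 he
    obtain ⟨x, hx⟩ := hne e he
    obtain ⟨w, hw, hlw⟩ := (hl x hx).exists_mem_erase hx
    have : ch e = e.erase w := by
      ext c
      simp only [ch, Finset.mem_filter, Finset.mem_erase]
      constructor
      · rintro ⟨hc, h⟩
        exact ⟨fun h' => h (h' ▸ hlw), hc⟩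
      · rintro ⟨hcw, hc⟩
        exact ⟨hc, fun h => hcw (hs e he c hc w hw (h.symm.trans hlw))⟩
    rw [this, Finset.cast_card_erase_of_mem hw]
  have hdisj : ∀ e ∈ S, ∀ f ∈ S, e ≠ f → Disjoint (ch e) (ch f) := by
    intro e he f hf hef
    rw [Finset.disjoint_left]
    intro c hce hcf
    obtain ⟨he, hl⟩ := Finset.mem_filter.1 he
    obtain ⟨hf, -⟩ := Finset.mem_filter.1 hf
    obtain ⟨hce, hnl⟩ := Finset.mem_filter.1 hce
    obtain ⟨hcf, hnl'⟩ := Finset.mem_filter.1 hcf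
    exact hef (hs.isParent_unique (hs.isParent_iff.2 ⟨he, hce, hl c hce, hnl⟩)
      (hs.isParent_iff.2 ⟨hf, hcf, hl c hce, hnl'⟩))
  have hun : S.biUnion ch = (E.filter (Linked s u)).erase u := by
    ext c
    simp only [Finset.mem_biUnion, Finset.mem_erase, Finset.mem_filter, ch, hS]
    constructor
    · rintro ⟨e, ⟨he, hl⟩, hc, hnl⟩
      exact ⟨fun h => hnl (h ▸ Linked.refl _ _), hE e he hc, hl c hc⟩
    · rintro ⟨hcu, -, hl⟩
      obtain ⟨e, he⟩ := exists_isParent hl (Ne.symm hcu)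
      obtain ⟨he, hce, -, hnl⟩ := hs.isParent_iff.1 he
      exact ⟨e, ⟨he, fun x hx => hl.trans (Linked.of_mem he hce hx)⟩, hce, hnl⟩
  rw [Finset.sum_congr rfl hch, ← Nat.cast_sum, ← Finset.card_biUnion hdisj, hun,
    Finset.cast_card_erase_of_mem (Finset.mem_filter.2 ⟨hu, Linked.refl _ _⟩)]

/-- Attach `v` to `d`: a hyperedge `d` is enlarged by `v`, to a vertex `v` is joined by a new
hyperedge of size two. -/
def attach (v : V) (s : Finset (Finset V)) (d : Finset V) : Finset (Finset V) :=
  insert (insert v d) (s.erase d)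

/-! ### Attaching and detaching a vertex are mutually inverse -/

section attach

variable {s : Finset (Finset V)} {u v : V} {d : Finset V}

theorem IsStub.insert_notMem (hd : IsStub s u d) (huv : ¬ Linked s u v) : insert v d ∉ s := by
  intro h
  obtain ⟨x, hx⟩ := hd.nonempty
  exact huv ((hd.linked x hx).trans (Linked.of_mem h (Finset.mem_insert_of_mem hx)
    (Finset.mem_insert_self _ _)))

theorem IsStub.erase_attach (hd : IsStub s u d) (huv : ¬ Linked s u v) :
    (attach v s d).erase (insert v d) = s.erase d :=
  Finset.erase_insert fun h => hd.insert_notMem huv (Finset.mem_of_mem_erase h)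

theorem Acyclic.attach (hs : Acyclic s) (huv : ¬ Linked s u v) (hd : IsStub s u d) :
    Acyclic (attach v s d) := by
  intro g hg a ha b hb hab
  by_cases hgd : g = insert v d
  · subst hgd
    rw [hd.erase_attach huv] at hab
    have hab' := hab.mono (Finset.erase_subset _ _)
    rw [Finset.mem_insert] at ha hb
    rcases ha with rfl | ha <;> rcases hb with rfl | hb
    · rfl
    · exact absurd ((hd.linked b hb).trans hab'.symm) huv
    · exact absurd ((hd.linked a ha).trans hab') huv
    · rcases hd.mem_or with h | h
      · exact hs d h a ha b hb hab
      · exact Finset.card_le_one.1 h.le a ha b hb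
  · have hg' : g ≠ d ∧ g ∈ s := Finset.mem_erase.1 ((Finset.mem_insert.1 hg).resolve_left hgd)
    have hin : ∀ x ∈ d, ∀ y ∈ d, Linked (s.erase g) x y := by
      intro x hx y hy
      rcases hd.mem_or with h | h
      · exact Linked.of_mem (Finset.mem_erase.2 ⟨hg'.1.symm, h⟩) hx hy
      · rw [Finset.card_le_one.1 h.le x hx y hy]
        exact Linked.refl _ _
    have hsub : ((s.erase d).erase g) ⊆ s.erase g :=
      Finset.erase_subset_erase _ (Finset.erase_subset _ _)
    -- A member `g` of `s` meeting both the side of `v` and that of `d` would link `u` to `v`.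
    have hcross : ∀ q ∈ d, ∀ x ∈ g, ∀ y ∈ g, Linked (s.erase g) x v →
        Linked (s.erase g) q y → False := by
      intro q hq x hx y hy hxv hqy
      exact huv ((hd.linked q hq).trans ((hqy.mono (Finset.erase_subset _ _)).trans
        ((Linked.of_mem hg'.2 hy hx).trans (hxv.mono (Finset.erase_subset _ _)))))
    have hab' : Linked (insert (insert v d) ((s.erase d).erase g)) a b := by
      refine hab.mono fun k hk => ?_
      simp only [Hyperforest.attach, Finset.mem_erase, Finset.mem_insert] at hk ⊢
      tauto
    refine hs g hg'.2 a ha b hb ?_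
    rcases hab'.of_insert with h | ⟨p, hp, q, hq, h1, h2⟩
    · exact h.mono hsub
    replace h1 := h1.mono hsub
    replace h2 := h2.mono hsub
    rw [Finset.mem_insert] at hp hq
    rcases hp with rfl | hp <;> rcases hq with rfl | hq
    · exact h1.trans h2
    · exact (hcross q hq a ha b hb h1 h2).elim
    · exact (hcross p hp b hb a ha h2.symm h1.symm).elim
    · exact h1.trans ((hin p hp q hq).trans h2)

/-- As the unique parent of `v`, the new member can be recognized in the result; this makes
attaching injective. -/
theorem IsStub.isParent_attach (hd : IsStub s u d) (huv : ¬ Linked s u v) :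
    IsParent (Hyperforest.attach v s d) u v (insert v d) := by
  refine ⟨Finset.mem_insert_self _ _, Finset.mem_insert_self _ _, ?_⟩
  obtain ⟨x, hx⟩ := hd.nonempty
  obtain ⟨w, hw, hl⟩ := (hd.linked x hx).exists_mem_erase hx
  refine ⟨w, Finset.mem_insert_of_mem hw, fun h => hd.notMem huv (h ▸ hw), ?_⟩
  rwa [hd.erase_attach huv]

/-- Remove `v` from the member `e`, and `e` as well if only one vertex is left. -/
def detach (v : V) (s : Finset (Finset V)) (e : Finset V) : Finset (Finset V) :=
  (insert (e.erase v) (s.erase e)).filter fun g => 2 ≤ g.card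

theorem IsStub.detach_attach (h2 : ∀ e ∈ s, 2 ≤ e.card) (hd : IsStub s u d)
    (huv : ¬ Linked s u v) : detach v (Hyperforest.attach v s d) (insert v d) = s := by
  rw [detach, hd.erase_attach huv, Finset.erase_insert (hd.notMem huv)]
  ext g
  simp only [Finset.mem_filter, Finset.mem_insert, Finset.mem_erase]
  constructor
  · rintro ⟨rfl | h, hg⟩
    · exact hd.mem_or.resolve_right (by omega)
    · exact h.2
  · intro hg
    exact ⟨or_iff_not_imp_left.2 fun h => ⟨h, hg⟩, h2 g hg⟩

variable {e : Finset V}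

theorem Acyclic.detach (hs : Acyclic s) (he : e ∈ s) : Acyclic (detach v s e) := by
  refine Acyclic.mono (t := insert (e.erase v) (s.erase e)) ?_ (Finset.filter_subset _ _)
  intro g hg a ha b hb hab
  by_cases hge : g = e.erase v
  · subst hge
    refine hs e he a (Finset.mem_of_mem_erase ha) b (Finset.mem_of_mem_erase hb)
      (hab.mono fun k hk => ?_)
    exact (Finset.mem_insert.1 (Finset.mem_erase.1 hk).2).resolve_left (Finset.mem_erase.1 hk).1
  · have hg' := Finset.mem_erase.1 ((Finset.mem_insert.1 hg).resolve_left hge)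
    refine hs g hg'.2 a ha b hb (hab.of_forall fun k hk x hx y hy => ?_)
    rw [Finset.mem_erase, Finset.mem_insert] at hk
    obtain ⟨hkg, rfl | hk⟩ := hk
    · exact Linked.of_mem (Finset.mem_erase.2 ⟨hg'.1.symm, he⟩) (Finset.mem_of_mem_erase hx)
        (Finset.mem_of_mem_erase hy)
    · exact Linked.of_mem (Finset.mem_erase.2 ⟨hkg, Finset.mem_of_mem_erase hk⟩) hx hy

theorem Acyclic.not_linked_detach (hs : Acyclic s) (he : IsParent s u v e) :
    ¬ Linked (Hyperforest.detach v s e) u v := by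
  intro h
  obtain ⟨hes, hv, -, hnl⟩ := hs.isParent_iff.1 he
  replace h := h.mono (Finset.filter_subset _ _)
  rcases h.of_insert with h | ⟨p, hp, q, hq, -, h⟩
  · exact hnl h
  · rw [Finset.mem_erase] at hq
    exact hq.1 (hs e hes q hq.2 v hv h)

theorem IsParent.isStub_detach (h2 : ∀ e ∈ s, 2 ≤ e.card) (he : IsParent s u v e) :
    IsStub (Hyperforest.detach v s e) u (e.erase v) := by
  obtain ⟨hes, hv, w, hw, hwv, hl⟩ := he
  have hw' : w ∈ e.erase v := Finset.mem_erase.2 ⟨hwv, hw⟩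
  have hmem : e.erase v ∈ Hyperforest.detach v s e ∨ (e.erase v).card = 1 := by
    have := Finset.card_pos.2 ⟨w, hw'⟩
    rcases Nat.lt_or_ge 1 (e.erase v).card with h | h
    · exact Or.inl (Finset.mem_filter.2 ⟨Finset.mem_insert_self _ _, h⟩)
    · exact Or.inr (by omega)
  refine ⟨⟨w, hw'⟩, hmem, fun x hx => ?_⟩
  have hlw : Linked (Hyperforest.detach v s e) u w := hl.mono fun g hg =>
    Finset.mem_filter.2 ⟨Finset.mem_insert_of_mem hg, h2 g (Finset.mem_of_mem_erase hg)⟩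
  rcases hmem with h | h
  · exact hlw.trans (Linked.of_mem h hw' hx)
  · exact Finset.card_le_one.1 h.le w hw' x hx ▸ hlw

theorem Acyclic.attach_detach (hs : Acyclic s) (h2 : ∀ e ∈ s, 2 ≤ e.card)
    (he : IsParent s u v e) :
    Hyperforest.attach v (Hyperforest.detach v s e) (e.erase v) = s := by
  obtain ⟨hes, hv, -⟩ := he
  have hnot : e.erase v ∉ s.erase e := by
    intro h
    rw [Finset.mem_erase] at h
    obtain ⟨a, ha, b, hb, hab⟩ := Finset.one_lt_card.1 (h2 _ h.2)
    exact hab (hs.eq_of_mem h.2 hes h.1 ha (Finset.mem_of_mem_erase ha) hb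
      (Finset.mem_of_mem_erase hb))
  have : (Hyperforest.detach v s e).erase (e.erase v) = s.erase e := by
    ext g
    rw [Hyperforest.detach, Finset.mem_erase, Finset.mem_filter, Finset.mem_insert]
    constructor
    · rintro ⟨h1, h, -⟩
      exact h.resolve_left h1
    · intro h
      exact ⟨fun h' => hnot (h' ▸ h), Or.inr h, h2 g (Finset.mem_of_mem_erase h)⟩
  rw [Hyperforest.attach, this, Finset.insert_erase hv, Finset.insert_erase hes]

end attach

end Hyperforest

/-! ### Weights, cancellation and the Möbius function -/

namespace Hyperforest

variable {V : Type*}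

/-- The Möbius function of a hyperedge with `j` vertices. -/
def edgeWeight (j : ℕ) : ℤ := -((j - 2)! : ℤ)

theorem edgeWeight_succ {j : ℕ} (hj : 2 ≤ j) :
    edgeWeight (j + 1) = ((j : ℤ) - 1) * edgeWeight j := by
  obtain ⟨k, rfl⟩ := Nat.exists_eq_add_of_le' hj
  have : k + 2 + 1 - 2 = k + 1 := by omega
  simp only [edgeWeight, this, Nat.add_sub_cancel, Nat.factorial_succ]
  push_cast
  ring

/-- The product of the weights of the members of a family. -/
def weight (s : Finset (Finset V)) : ℤ := ∏ e ∈ s, edgeWeight e.card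

theorem weight_eq_finprod (F : Hyperforest V) :
    weight F.edges = ∏ᶠ (j : ℕ) (_ : 2 ≤ j), (-((j - 2)! : ℤ)) ^ F.kappa j := by
  refine Eq.trans ?_ (finprod_mem_eq_prod_of_subset (s := {j : ℕ | 2 ≤ j})
    (t := F.edges.image Finset.card) _ ?_ ?_).symm
  · rw [weight, ← Finset.prod_fiberwise_of_maps_to fun e he => Finset.mem_image_of_mem Finset.card he]
    refine Finset.prod_congr rfl fun j _ => ?_
    rw [kappa, ← Finset.prod_const]
    exact Finset.prod_congr rfl fun e he => by rw [edgeWeight, (Finset.mem_filter.1 he).2]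
  · rintro j ⟨-, hj⟩
    rw [Function.mem_mulSupport] at hj
    by_contra hn
    refine hj ?_
    have : F.kappa j = 0 := by
      rw [kappa, Finset.card_eq_zero, Finset.filter_eq_empty_iff]
      exact fun e he h => hn (Finset.mem_coe.2 (h ▸ Finset.mem_image_of_mem _ he))
    rw [this, pow_zero]
  · intro j hj
    obtain ⟨e, he, rfl⟩ := Finset.mem_image.1 (Finset.mem_coe.1 hj)
    exact F.two_le_card e he

variable [DecidableEq V]

section attach

variable {s : Finset (Finset V)} {u v : V} {d : Finset V}

theorem IsStub.weight_attach (hd : IsStub s u d) (huv : ¬ Linked s u v) :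
    weight (attach v s d) = edgeWeight (d.card + 1) * weight (s.erase d) := by
  rw [weight, attach, Finset.prod_insert fun h =>
    hd.insert_notMem huv (Finset.mem_of_mem_erase h), Finset.card_insert_of_notMem (hd.notMem huv),
    weight]

theorem weight_attach_singleton (h2 : ∀ e ∈ s, 2 ≤ e.card) (huv : ¬ Linked s u v) {c : V}
    (hd : IsStub s u {c}) : weight (attach v s {c}) = -weight s := by
  have hc : {c} ∉ s := fun h => by simpa using h2 _ h
  rw [hd.weight_attach huv, Finset.erase_eq_of_notMem hc]
  simp [edgeWeight]

theorem weight_attach_of_mem (h2 : ∀ e ∈ s, 2 ≤ e.card) (huv : ¬ Linked s u v)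
    (hd : IsStub s u d) (hds : d ∈ s) :
    weight (attach v s d) = ((d.card : ℤ) - 1) * weight s := by
  rw [hd.weight_attach huv, edgeWeight_succ (h2 d hds), mul_assoc, weight, weight,
    Finset.mul_prod_erase s (fun e => edgeWeight e.card) hds]

end attach

open Classical in
/-- The places inside `E` where a new vertex can be attached to the component of `u`. -/
noncomputable def stubs (s : Finset (Finset V)) (u : V) (E : Finset V) : Finset (Finset V) :=
  (E.filter (Linked s u)).image singleton ∪ s.filter fun d => d ⊆ E ∧ ∀ x ∈ d, Linked s u x

theorem mem_stubs {s : Finset (Finset V)} (h2 : ∀ e ∈ s, 2 ≤ e.card) {u : V} {E d : Finset V} :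
    d ∈ stubs s u E ↔ IsStub s u d ∧ d ⊆ E := by
  simp only [stubs, Finset.mem_union, Finset.mem_image, Finset.mem_filter]
  constructor
  · rintro (⟨c, ⟨hc, hl⟩, rfl⟩ | ⟨hd, hdE, hl⟩)
    · exact ⟨⟨Finset.singleton_nonempty c, Or.inr (Finset.card_singleton c), by simpa using hl⟩,
        by simpa using hc⟩
    · exact ⟨⟨Finset.card_pos.1 (by have := h2 d hd; omega), Or.inl hd, hl⟩, hdE⟩
  · rintro ⟨⟨-, h | h, hl⟩, hdE⟩
    · exact Or.inr ⟨h, hdE, hl⟩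
    · obtain ⟨c, rfl⟩ := Finset.card_eq_one.1 h
      exact Or.inl ⟨c, ⟨by simpa using hdE, by simpa using hl⟩, rfl⟩

/-- A connection inside `E` exists and provides a parent inside `E`; parents are unique. -/
theorem Acyclic.isParent_subset {r s : Finset (Finset V)} (hr : Acyclic r)
    (hs : Acyclic s) (h : ∀ g ∈ s, ∃ f ∈ r, g ⊆ f) {E : Finset V} (hE : E ∈ r) {u v : V}
    (hu : u ∈ E) (hv : v ∈ E) (huv : u ≠ v) {e : Finset V} (he : IsParent s u v e) : e ⊆ E := by
  obtain ⟨f, hf, hvf, w, hw, hwv, hl⟩ :=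
    exists_isParent (hr.linked_filter_subset h hE hu hv he.linked) huv
  rw [Finset.mem_filter] at hf
  have : IsParent s u v f :=
    ⟨hf.1, hvf, w, hw, hwv, hl.mono (Finset.erase_subset_erase _ (Finset.filter_subset _ _))⟩
  rw [hs.isParent_unique he this]
  exact hf.2

open Classical in
theorem sum_weight_attach {r s : Finset (Finset V)} (hr : Acyclic r) (hs : Acyclic s)
    (h2 : ∀ e ∈ s, 2 ≤ e.card) (h : ∀ g ∈ s, ∃ f ∈ r, g ⊆ f) {E : Finset V} (hE : E ∈ r)
    {u v : V} (hu : u ∈ E) (huv : ¬ Linked s u v) :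
    ∑ d ∈ stubs s u E, weight (attach v s d) = -weight s := by
  -- Inside `E`, connectivity needs only the members contained in `E`, so the tree count applies to
  -- these alone.
  have hiff : ∀ x ∈ E, Linked s u x ↔ Linked (s.filter (· ⊆ E)) u x := fun x hx =>
    ⟨hr.linked_filter_subset h hE hu hx, fun h => h.mono (Finset.filter_subset _ _)⟩
  have hmem := fun d => mem_stubs h2 (u := u) (E := E) (d := d)
  have hcount := (hs.mono (Finset.filter_subset (· ⊆ E) s)).sum_card_sub_one
    (fun e he => Finset.card_pos.1 (by have := h2 e (Finset.mem_filter.1 he).1; omega))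
    (fun e he => (Finset.mem_filter.1 he).2) hu
  have hC : E.filter (Linked (s.filter (· ⊆ E)) u) = E.filter (Linked s u) :=
    Finset.filter_congr fun x hx => (hiff x hx).symm
  have hS : (s.filter (· ⊆ E)).filter (fun e => ∀ x ∈ e, Linked (s.filter (· ⊆ E)) u x) =
      s.filter fun d => d ⊆ E ∧ ∀ x ∈ d, Linked s u x := by
    ext d
    simp only [Finset.mem_filter, and_assoc]
    refine and_congr_right fun _ => and_congr_right fun hdE => forall₂_congr fun x hx => ?_
    simpa only [Finset.mem_filter] using (hiff x (hdE hx)).symm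
  rw [hC, hS] at hcount
  have hdisj : Disjoint ((E.filter (Linked s u)).image singleton)
      (s.filter fun d => d ⊆ E ∧ ∀ x ∈ d, Linked s u x) := by
    rw [Finset.disjoint_left]
    intro d hd hd'
    obtain ⟨c, -, rfl⟩ := Finset.mem_image.1 hd
    simpa using h2 _ (Finset.mem_filter.1 hd').1
  have h1 : ∑ c ∈ E.filter (Linked s u), weight (attach v s {c}) =
      ∑ c ∈ E.filter (Linked s u), -weight s :=
    Finset.sum_congr rfl fun c hc => weight_attach_singleton h2 huv
      ((hmem {c}).1 (Finset.mem_union_left _ (Finset.mem_image_of_mem _ hc))).1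
  have h3 : ∑ d ∈ s.filter (fun d => d ⊆ E ∧ ∀ x ∈ d, Linked s u x), weight (attach v s d) =
      ∑ d ∈ s.filter (fun d => d ⊆ E ∧ ∀ x ∈ d, Linked s u x), ((d.card : ℤ) - 1) * weight s :=
    Finset.sum_congr rfl fun d hd => weight_attach_of_mem h2 huv
      ((hmem d).1 (Finset.mem_union_right _ hd)).1 (Finset.mem_filter.1 hd).1
  rw [stubs, Finset.sum_union hdisj, Finset.sum_image fun _ _ _ _ h => Finset.singleton_injective h,
    h1, h3, ← Finset.sum_mul, hcount, Finset.sum_const, nsmul_eq_mul]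
  ring

open Classical in
theorem sum_weight_linked (F : Hyperforest V) {E : Finset V} (hE : E ∈ F.edges) {u v : V}
    (hu : u ∈ E) (hv : v ∈ E) (huv : u ≠ v) :
    ∑ s ∈ F.lowerEdges.filter (fun s => Linked s u v), weight s =
      ∑ s ∈ F.lowerEdges.filter (fun s => ¬ Linked s u v),
        ∑ d ∈ stubs s u E, weight (attach v s d) := by
  rw [Finset.sum_sigma']
  symm
  -- The inverse detaches `v` from its parent.
  refine Finset.sum_bij (fun p _ => attach v p.1 p.2) ?_ ?_ ?_ fun _ _ => rfl
  · rintro ⟨s, d⟩ hp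
    simp only [Finset.mem_sigma, Finset.mem_filter, mem_lowerEdges] at hp ⊢
    obtain ⟨⟨⟨h2, hs, hle⟩, hnl⟩, hd⟩ := hp
    obtain ⟨hd, hdE⟩ := (mem_stubs h2).1 hd
    refine ⟨⟨?_, hs.attach hnl hd, ?_⟩, (hd.isParent_attach hnl).linked⟩
    · intro e he
      rcases Finset.mem_insert.1 he with rfl | he
      · have := hd.nonempty.card_pos
        rw [Finset.card_insert_of_notMem (hd.notMem hnl)]
        omega
      · exact h2 e (Finset.mem_of_mem_erase he)
    · intro e he
      rcases Finset.mem_insert.1 he with rfl | he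
      · exact ⟨E, hE, Finset.insert_subset hv hdE⟩
      · exact hle e (Finset.mem_of_mem_erase he)
  · rintro ⟨s, d⟩ hp ⟨s', d'⟩ hp' heq
    simp only [Finset.mem_sigma, Finset.mem_filter, mem_lowerEdges] at hp hp' heq
    obtain ⟨⟨⟨h2, hs, -⟩, hnl⟩, hd⟩ := hp
    obtain ⟨⟨⟨h2', hs', -⟩, hnl'⟩, hd'⟩ := hp'
    replace hd := ((mem_stubs h2).1 hd).1
    replace hd' := ((mem_stubs h2').1 hd').1
    have hins : insert v d = insert v d' := (hs.attach hnl hd).isParent_unique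
      (hd.isParent_attach hnl) (heq ▸ hd'.isParent_attach hnl')
    have hdd : d = d' := by
      rw [← Finset.erase_insert (hd.notMem hnl), hins, Finset.erase_insert (hd'.notMem hnl')]
    have hss : s = s' := by
      rw [← hd.detach_attach h2 hnl, heq, hins, hd'.detach_attach h2' hnl']
    subst hdd hss
    rfl
  · intro s hs
    simp only [Finset.mem_filter, mem_lowerEdges] at hs
    obtain ⟨⟨h2, hs, hle⟩, hl⟩ := hs
    obtain ⟨e, he⟩ := exists_isParent hl huv
    have heE := F.acyclic_edges.isParent_subset hs hle hE hu hv huv he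
    have h2' : ∀ g ∈ detach v s e, 2 ≤ g.card := fun g hg => (Finset.mem_filter.1 hg).2
    refine ⟨⟨detach v s e, e.erase v⟩, ?_, hs.attach_detach h2 he⟩
    simp only [Finset.mem_sigma, Finset.mem_filter, mem_lowerEdges]
    refine ⟨⟨⟨h2', hs.detach he.1, ?_⟩, hs.not_linked_detach he⟩,
      (mem_stubs h2').2 ⟨he.isStub_detach h2, (Finset.erase_subset _ _).trans heE⟩⟩
    intro g hg
    rcases Finset.mem_insert.1 (Finset.mem_filter.1 hg).1 with rfl | hg
    · exact ⟨E, hE, (Finset.erase_subset _ _).trans heE⟩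
    · exact hle g (Finset.mem_of_mem_erase hg)

open Classical in
theorem sum_weight_lowerEdges (F : Hyperforest V) {E : Finset V} (hE : E ∈ F.edges) :
    ∑ s ∈ F.lowerEdges, weight s = 0 := by
  obtain ⟨u, hu, v, hv, huv⟩ := Finset.one_lt_card.1 (F.two_le_card E hE)
  rw [← Finset.sum_filter_add_sum_filter_not _ (fun s => Linked s u v),
    sum_weight_linked F hE hu hv huv, ← Finset.sum_add_distrib]
  refine Finset.sum_eq_zero fun s hs => ?_
  simp only [Finset.mem_filter, mem_lowerEdges] at hs
  obtain ⟨⟨h2, hs, hle⟩, hnl⟩ := hs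
  rw [sum_weight_attach F.acyclic_edges hs h2 hle hE hu hnl, neg_add_cancel]

theorem sum_weight_Iic (F : Hyperforest V) :
    ∑ G ∈ Finset.Iic F, weight G.edges = if F = ⊥ then 1 else 0 := by
  split_ifs with h
  · subst h
    rw [Finset.Iic_bot, Finset.sum_singleton]
    exact Finset.prod_empty
  · obtain ⟨E, hE⟩ : F.edges.Nonempty := by
      rw [Finset.nonempty_iff_ne_empty]
      exact fun h' => h (Hyperforest.ext h')
    rw [← sum_weight_lowerEdges F hE, lowerEdges,
      Finset.sum_image fun _ _ _ _ h => Hyperforest.ext h]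

theorem mu_bot_eq_weight (F : Hyperforest V) :
    IncidenceAlgebra.mu ℤ (⊥ : Hyperforest V) F = weight F.edges := by
  induction hn : (Finset.Iic F).card using Nat.strong_induction_on generalizing F with
  | _ n ih =>
    have hIcc : Finset.Icc ⊥ F = insert F (Finset.Iio F) := by
      ext G
      simp [le_iff_eq_or_lt]
    have hIic : Finset.Iic F = insert F (Finset.Iio F) := by
      ext G
      simp [le_iff_eq_or_lt]
    have h1 := IncidenceAlgebra.sum_Icc_mu_right (𝕜 := ℤ) (⊥ : Hyperforest V) F
    have h2 := sum_weight_Iic F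
    rw [hIcc, Finset.sum_insert (by simp)] at h1
    rw [hIic, Finset.sum_insert (by simp)] at h2
    have h3 : ∑ G ∈ Finset.Iio F, IncidenceAlgebra.mu ℤ (⊥ : Hyperforest V) G =
        ∑ G ∈ Finset.Iio F, weight G.edges :=
      Finset.sum_congr rfl fun G hG => ih _ (hn ▸ Finset.card_lt_card
        (Finset.Iic_ssubset_Iic.2 (Finset.mem_Iio.1 hG))) G rfl
    simp only [eq_comm (a := (⊥ : Hyperforest V))] at h1
    linarith

end Hyperforest

theorem proposition6p1 (F : Hyperforest ℕ+) :
    IncidenceAlgebra.mu ℤ (⊥ : Hyperforest ℕ+) F =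
      ∏ᶠ (j : ℕ) (_ : 2 ≤ j), (-((j - 2)! : ℤ)) ^ F.kappa j := by
  rw [F.mu_bot_eq_weight, F.weight_eq_finprod]
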